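/- Let $n\ge 1$. For every nonempty compact metric space $X$ there exist a Peano continuum $Y$ (a nonempty compact, connected, locally connected metrizable space) and a topological embedding $i:X\to Y$, by which $X$ is regarded as a subspace of $Y$, such that 1. $Y\setminus X$ is a disjoint union of at most countably many open arcs, i.e. with the subspace topology it is homeomorphic to a topological disjoint union of at most countably many copies of the open interval $(0,1)$; 2. the inclusion $i:X\to Y$ is $\pi_1$-injective, i.e. the induced homomorphism $\pi_1(X,x)\to\pi_1(Y,x)$ is injective for every $x\in X$; 3. $\mathbf{w}_n(X)\subseteq \mathbf{w}_n(Y)\subseteq X$; 4. $\dim(Y)=\max\{1,\dim(X)\}$. Here $\dim$ is the Lebesgue covering dimension (possibly $\infty$). For a space $Z$, $\mathbf{w}_n(Z)$ is the $\pi_n$-wild set of $Z$, defined as follows. The $n$-dimensional infinite earring $\mathbb{E}_n$ is the one-point union of a sequence $S_1,S_2,\dots$ of copies of the unit $n$-sphere $S^n$, joined at their basepoints $(1,0,\dots,0)$ to a point $b_0$, where a set $U$ is open if and only if $U\cap S_j$ is open in $S_j$ for every $j$ and, whenever $b_0\in U$, $S_j\subseteq U$ for all but finitely many $j$. Then $\mathbf{w}_n(Z)$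 is the set of all $z\in Z$ for which there is a continuous map $f:\mathbb{E}_n\to Z$ with $f(b_0)=z$ whose restriction to each sphere $S_j$ is not null-homotopic in $Z$. -/

import Mathlib

open Set

universe u

/-- A Peano continuum: a nonempty, compact, connected, locally connected metrizable space
(`ConnectedSpace` includes nonemptiness). -/
class IsPeanoContinuum (Y : Type u) [TopologicalSpace Y] : Prop where
  metrizable : TopologicalSpace.MetrizableSpace Y
  compact : CompactSpace Y
  connected : ConnectedSpace Y
  locallyConnected : LocallyConnectedSpace Y

/-- The subspace `S` is a (topological) disjoint union of at most countably many open arcs: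
it is homeomorphic to a coproduct of countably many copies of the open interval `(0,1)`. -/
def IsCountableDisjointUnionOfOpenArcs {Y : Type u} [TopologicalSpace Y] (S : Set Y) : Prop :=
  ∃ (ι : Type) (_ : Countable ι), Nonempty (S ≃ₜ (Σ _ : ι, Ioo (0 : ℝ) 1))

/-- `i` is `π₁`-injective: the induced homomorphism on fundamental groups is injective at every
basepoint. -/
def IsPiOneInjective {X Y : Type u} [TopologicalSpace X] [TopologicalSpace Y] (i : C(X, Y)) :
    Prop :=
  ∀ x : X, Function.Injective (FundamentalGroup.map i x)

section ShrinkingWedge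

variable (A : ℕ → Type u) (a : ∀ j, A j)

/-- The equivalence relation on the disjoint union of the `A j` that identifies all the
basepoints `a j` with each other. -/
def wedgeSetoid : Setoid (Σ j, A j) where
  r s t := s = t ∨ (s.2 = a s.1 ∧ t.2 = a t.1)
  iseqv :=
    { refl := fun _ => Or.inl rfl
      symm := by
        rintro s t (h | ⟨h₁, h₂⟩)
        · exact Or.inl h.symm
        · exact Or.inr ⟨h₂, h₁⟩
      trans := by
        rintro s t w (rfl | ⟨h₁, h₂⟩) (rfl | ⟨h₃, h₄⟩)
        · exact Or.inl rfl
        · exact Or.inr ⟨h₃, h₄⟩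
        · exact Or.inr ⟨h₁, h₂⟩
        · exact Or.inr ⟨h₁, h₄⟩ }

/-- The underlying set of the shrinking wedge of the sequence `(A j, a j)` of based spaces:
the one-point union. -/
def ShrinkingWedge : Type u := Quotient (wedgeSetoid A a)

namespace ShrinkingWedge

/-- The canonical map of the `j`-th space into the wedge. -/
def incl (j : ℕ) (p : A j) : ShrinkingWedge A a := Quotient.mk (wedgeSetoid A a) ⟨j, p⟩

/-- The wedgepoint `b₀`. -/
def base : ShrinkingWedge A a := incl A a 0 (a 0)

/-- A set `U` is open in the shrinking wedge if its trace on every `A j` is open and, whenever it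
contains the wedgepoint, it contains all but finitely many of the `A j`. -/
instance [∀ j, TopologicalSpace (A j)] : TopologicalSpace (ShrinkingWedge A a) where
  IsOpen U := (∀ j, IsOpen (incl A a j ⁻¹' U)) ∧
    (base A a ∈ U → {j | ¬ range (incl A a j) ⊆ U}.Finite)
  isOpen_univ := ⟨fun _ => isOpen_univ, fun _ => by simp⟩
  isOpen_inter := by
    rintro U V ⟨hU, hU'⟩ ⟨hV, hV'⟩
    refine ⟨fun j => (hU j).inter (hV j), fun h => ((hU' h.1).union (hV' h.2)).subset ?_⟩
    intro j hj
    simp only [mem_ofPred_eq, subset_inter_iff, not_and_or] at hj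
    exact hj
  isOpen_sUnion := by
    intro S hS
    refine ⟨fun j => ?_, ?_⟩
    · rw [preimage_sUnion]
      exact isOpen_biUnion fun U hU => (hS U hU).1 j
    · rintro ⟨U, hU, hb⟩
      refine ((hS U hU).2 hb).subset fun j hj h => hj (h.trans (subset_sUnion_of_mem hU))

/-- The canonical map of the `j`-th space into the wedge, as a continuous map. -/
def inclC [∀ j, TopologicalSpace (A j)] (j : ℕ) : C(A j, ShrinkingWedge A a) where
  toFun := incl A a j
  continuous_toFun := ⟨fun _ hU => hU.1 j⟩

end ShrinkingWedge

end ShrinkingWedge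

/-- The unit `n`-sphere in `ℝⁿ⁺¹`. -/
abbrev NSphere (n : ℕ) : Type := Metric.sphere (0 : EuclideanSpace ℝ (Fin (n + 1))) 1

/-- The basepoint `s₀ = (1, 0, …, 0)` of the unit `n`-sphere. -/
noncomputable def NSphere.base (n : ℕ) : NSphere n :=
  ⟨EuclideanSpace.single 0 1, by simp⟩

/-- The `n`-dimensional infinite earring space: the shrinking wedge of countably many
`n`-spheres. -/
abbrev Earring (n : ℕ) : Type :=
  ShrinkingWedge (fun _ : ℕ => NSphere n) (fun _ => NSphere.base n)

/-- The wedgepoint `b₀` of the `n`-dimensional infinite earring. -/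
noncomputable def Earring.base (n : ℕ) : Earring n :=
  ShrinkingWedge.base (fun _ : ℕ => NSphere n) (fun _ => NSphere.base n)

/-- The inclusion `ℓ_j` of the `j`-th sphere into the `n`-dimensional infinite earring. -/
noncomputable def Earring.sphereIncl (n j : ℕ) : C(NSphere n, Earring n) :=
  ShrinkingWedge.inclC (fun _ : ℕ => NSphere n) (fun _ => NSphere.base n) j

/-- A map `f` from the earring is fully essential if its restriction to each of the spheres is
essential, that is, not null-homotopic. -/
def IsFullyEssential {n : ℕ} {X : Type u} [TopologicalSpace X] (f : C(Earring n, X)) : Prop :=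
  ∀ j : ℕ, ¬ (f.comp (Earring.sphereIncl n j)).Nullhomotopic

/-- The `π_n`-wild set of `X`: the points `x` such that there is a fully essential based map
from the `n`-dimensional infinite earring to `(X, x)`. -/
def wildSet (n : ℕ) (X : Type u) [TopologicalSpace X] : Set X :=
  {x | ∃ f : C(Earring n, X), f (Earring.base n) = x ∧ IsFullyEssential f}

/-- Lebesgue covering dimension is at most `d`: every finite open cover has a finite open
refinement such that no point lies in more than `d + 1` of its members. -/
def HasCoveringDimLE (X : Type u) [TopologicalSpace X] (d : WithBot ℕ∞) : Prop :=
  ∀ 𝒰 : Set (Set X), 𝒰.Finite → (∀ U ∈ 𝒰, IsOpen U) → ⋃₀ 𝒰 = univ →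
    ∃ 𝒱 : Set (Set X), 𝒱.Finite ∧ (∀ V ∈ 𝒱, IsOpen V) ∧ ⋃₀ 𝒱 = univ ∧
      (∀ V ∈ 𝒱, ∃ U ∈ 𝒰, V ⊆ U) ∧
      ∀ x : X, (({V ∈ 𝒱 | x ∈ V}.encard : ℕ∞) : WithBot ℕ∞) ≤ d + 1

/-- Lebesgue covering dimension, with values in `{⊥, 0, 1, 2, …, ∞}`; the value `⊥` (in place of
the usual `-1`) is taken exactly on the empty space. -/
noncomputable def coveringDim (X : Type u) [TopologicalSpace X] : WithBot ℕ∞ :=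
  sInf {d : WithBot ℕ∞ | HasCoveringDimLE X d}

/-! Map the Cantor set `C` in `[0,1]` onto `X` by some `f`, and let `Y` be `[0,1]` with points of
`C` glued when `f` agrees on them (`exists_attach_unitInterval`). As a metrizable quotient of
`[0,1]`, `Y` is a Peano continuum. It contains `X` as the image of `C`, and `Y \ X` is the union of
the gaps of `C`.

For the homotopy statements one property suffices: a connected subset of `Y \ X` lies in one gap, so
it accumulates at finitely many points of `X`. Let `h : D → Y` with `D` simply connected send a
connected set `S` into `X`. Take a component `W` of the preimage of `Y \ X` and fill in its
complementary components missing `S`. The frontier of the resulting hull is connected because `D` is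
unicoherent, and `h` maps it into a finite set, so `h` is constant there. Hulls are nested or
disjoint, so `h` can be made constant on the unions of chains of hulls, which pushes it into `X`
without changing it on `S` (`exists_continuousMap_mem_of_finite_ends`). The plane with the boundary
of a square gives `π₁`-injectivity; `ℝⁿ⁺¹` with its unit sphere, connected as `n ≥ 1`, shows that
essential spheres stay essential, so wild points of `X` stay wild. No point of `Y \ X` is wild,
since open arcs are contractible.

For the dimension, closed sets off `X` embed in `[0,1]`, and
`hasCoveringDimLE_of_closed_of_disjoint_closed` combines them with `X`. The lower bounds come from
`X` being closed in `Y` and from `Y` being connected with two points. -/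

open Topology

/-! ### Complementary components, their hulls, and unicoherence. -/

section Connectedness

variable {D : Type*} [TopologicalSpace D]

theorem IsPreconnected.inter_frontier_nonempty {B F : Set D} (hB : IsPreconnected B)
    (h₁ : (B ∩ F).Nonempty) (h₂ : (B ∩ Fᶜ).Nonempty) : (B ∩ frontier F).Nonempty := by
  by_contra hne
  rw [not_nonempty_iff_eq_empty] at hne
  have hsub : B ⊆ interior F ∪ interior Fᶜ := by
    intro x hx
    have hx' : x ∉ frontier F := fun h => hne.subset ⟨hx, h⟩
    rw [frontier_eq_closure_inter_closure, mem_inter_iff, not_and_or] at hx'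
    rcases hx' with h | h
    · right; rwa [interior_compl]
    · left; rwa [closure_compl, notMem_compl_iff] at h
  obtain ⟨x, hxB, hxF⟩ := h₁
  obtain ⟨y, hyB, hyF⟩ := h₂
  have hx' : x ∈ interior F := (hsub hxB).resolve_right fun h => interior_subset h hxF
  have hy' : y ∈ interior Fᶜ := (hsub hyB).resolve_left fun h => hyF (interior_subset h)
  obtain ⟨z, -, hz₁, hz₂⟩ := hB _ _ isOpen_interior isOpen_interior hsub ⟨x, hxB, hx'⟩ ⟨y, hyB, hy'⟩
  exact interior_subset hz₂ (interior_subset hz₁)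

theorem IsClosed.isClosed_connectedComponentIn {A : Set D} (hA : IsClosed A) (x : D) :
    IsClosed (connectedComponentIn A x) := by
  by_cases hx : x ∈ A
  · refine isClosed_of_closure_subset ?_
    exact isPreconnected_connectedComponentIn.closure.subset_connectedComponentIn
      (subset_closure (mem_connectedComponentIn hx))
      (closure_minimal (connectedComponentIn_subset _ _) hA)
  · rw [connectedComponentIn_eq_empty hx]; exact isClosed_empty

theorem IsPreconnected.union_of_inter_closure {A W : Set D} (hA : IsPreconnected A)
    (hW : IsPreconnected W) (h : (A ∩ closure W).Nonempty) : IsPreconnected (A ∪ W) := by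
  obtain ⟨x, hxA, hxW⟩ := h
  have h1 : IsPreconnected (insert x W) :=
    hW.subset_closure (subset_insert _ _) (insert_subset hxW subset_closure)
  have h2 := hA.union x hxA (mem_insert x W) h1
  rwa [union_insert, ← insert_union, insert_eq_of_mem hxA] at h2

/-- A point of `connectedComponentIn Wᶜ x` outside the closure of `W` is interior to it. -/
theorem mem_interior_connectedComponentIn_compl [LocallyConnectedSpace D] {W : Set D} {x p : D}
    (hp : p ∈ connectedComponentIn Wᶜ x) (hpW : p ∉ closure W) :
    p ∈ interior (connectedComponentIn Wᶜ x) := by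
  rw [mem_interior_iff_mem_nhds, connectedComponentIn_eq hp]
  exact connectedComponentIn_mem_nhds
    (Filter.mem_of_superset (isClosed_closure.isOpen_compl.mem_nhds hpW)
      (compl_subset_compl.2 subset_closure))

/-- Boundary bumping: a component away from `closure W` would be clopen, by local connectedness. -/
theorem connectedComponentIn_compl_inter_closure [LocallyConnectedSpace D] [PreconnectedSpace D]
    {W : Set D} (hW : IsOpen W) (hne : W.Nonempty) {x : D} (hx : x ∉ W) :
    (connectedComponentIn Wᶜ x ∩ closure W).Nonempty := by
  by_contra h
  rw [not_nonempty_iff_eq_empty] at h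
  have hopen : IsOpen (connectedComponentIn Wᶜ x) := by
    rw [← subset_interior_iff_isOpen]
    intro p hp
    exact mem_interior_connectedComponentIn_compl hp
      fun hpW => h.subset ⟨hp, hpW⟩
  have hcl := hW.isClosed_compl.isClosed_connectedComponentIn x
  have := IsClopen.eq_univ ⟨hcl, hopen⟩ ⟨x, mem_connectedComponentIn hx⟩
  obtain ⟨w, hw⟩ := hne
  exact connectedComponentIn_subset Wᶜ x (this ▸ mem_univ w) hw

/-- The complement of a component of the complement of a connected open set is connected. -/
theorem isPreconnected_compl_connectedComponentIn_compl [LocallyConnectedSpace D]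
    [PreconnectedSpace D] {W : Set D} (hW : IsOpen W) (hWc : IsPreconnected W) (hne : W.Nonempty)
    (s : D) : IsPreconnected (connectedComponentIn Wᶜ s)ᶜ := by
  obtain ⟨w, hw⟩ := hne
  refine isPreconnected_of_forall w fun p hp => ?_
  by_cases hpW : p ∈ W
  · exact ⟨W, fun q hq hqC => connectedComponentIn_subset _ _ hqC hq, hw, hpW, hWc⟩
  refine ⟨connectedComponentIn Wᶜ p ∪ W, ?_, .inr hw, .inl (mem_connectedComponentIn hpW),
    isPreconnected_connectedComponentIn.union_of_inter_closure hWc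
      (connectedComponentIn_compl_inter_closure hW ⟨w, hw⟩ hpW)⟩
  rintro q (hq | hq) hqC
  · rw [connectedComponentIn_eq hqC, ← connectedComponentIn_eq hq] at hp
    exact hp (mem_connectedComponentIn hpW)
  · exact connectedComponentIn_subset _ _ hqC hq

theorem frontier_compl_connectedComponentIn_compl_subset [LocallyConnectedSpace D]
    {W : Set D} (hW : IsOpen W) (s : D) :
    frontier (connectedComponentIn Wᶜ s)ᶜ ⊆ frontier W := by
  intro p hp
  rw [frontier_compl, (hW.isClosed_compl.isClosed_connectedComponentIn s).frontier_eq] at hp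
  rw [hW.frontier_eq]
  refine ⟨?_, connectedComponentIn_subset _ _ hp.1⟩
  by_contra hpW
  exact hp.2 (mem_interior_connectedComponentIn_compl hp.1 hpW)

/-- The hulls of two disjoint connected open sets, obtained by filling all the complementary
components that do not contain `s`, are nested or disjoint. -/
theorem compl_connectedComponentIn_compl_nested [LocallyConnectedSpace D]
    [PreconnectedSpace D] {W W' : Set D} (hW : IsOpen W) (hWc : IsPreconnected W)
    (hne : W.Nonempty) (hW' : IsOpen W') (hWc' : IsPreconnected W') (hne' : W'.Nonempty)
    (hd : Disjoint W W') {s : D} (hs : s ∉ W) (hs' : s ∉ W') :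
    (connectedComponentIn Wᶜ s)ᶜ ⊆ (connectedComponentIn W'ᶜ s)ᶜ ∨
    (connectedComponentIn W'ᶜ s)ᶜ ⊆ (connectedComponentIn Wᶜ s)ᶜ ∨
    Disjoint (connectedComponentIn Wᶜ s)ᶜ (connectedComponentIn W'ᶜ s)ᶜ := by
  have key : ∀ {W W' : Set D}, IsOpen W → IsPreconnected W → W.Nonempty → s ∉ W →
      Disjoint W W' → W' ∩ connectedComponentIn Wᶜ s = ∅ →
      (connectedComponentIn W'ᶜ s)ᶜ ⊆ (connectedComponentIn Wᶜ s)ᶜ := by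
    intro W W' hW hWc hne hs hd h
    have h1 : IsPreconnected (connectedComponentIn Wᶜ s ∪ W) :=
      isPreconnected_connectedComponentIn.union_of_inter_closure hWc
        (connectedComponentIn_compl_inter_closure hW hne hs)
    refine compl_subset_compl.2 (subset_union_left.trans
      (h1.subset_connectedComponentIn (.inl (mem_connectedComponentIn hs)) ?_))
    rintro x (hx | hx) hxW'
    · exact h.subset ⟨hxW', hx⟩
    · exact hd.le_bot ⟨hx, hxW'⟩
  have sub : ∀ {W W' : Set D}, IsPreconnected W' → Disjoint W W' →
      (W' ∩ connectedComponentIn Wᶜ s).Nonempty → W' ⊆ connectedComponentIn Wᶜ s := by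
    rintro W W' hWc' hd ⟨x, hx, hxC⟩
    rw [connectedComponentIn_eq hxC]
    exact hWc'.subset_connectedComponentIn hx (disjoint_left.1 hd.symm)
  rcases (W' ∩ connectedComponentIn Wᶜ s).eq_empty_or_nonempty with h | h
  · exact .inr (.inl (key hW hWc hne hs hd h))
  rcases (W ∩ connectedComponentIn W'ᶜ s).eq_empty_or_nonempty with h' | h'
  · exact .inl (key hW' hWc' hne' hs' hd.symm h')
  right; right
  have h1 := sub hWc' hd h
  have h2 := sub hWc hd.symm h'
  -- The hull of `W` is connected and misses `W'`, so it lies in a single component of `W'ᶜ`; it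
  -- contains `W`, so this is the component of `s`.
  have hF := isPreconnected_compl_connectedComponentIn_compl hW hWc hne s
  obtain ⟨w, hw⟩ := hne
  have h3 : (connectedComponentIn Wᶜ s)ᶜ ⊆ connectedComponentIn W'ᶜ s := by
    rw [connectedComponentIn_eq (h2 hw)]
    exact hF.subset_connectedComponentIn (fun hwC => connectedComponentIn_subset _ _ hwC hw)
      (compl_subset_compl.2 h1)
  exact disjoint_compl_right_iff_subset.2 h3

/-- Simply connected, locally path-connected normal spaces are unicoherent. -/
theorem isPreconnected_inter_of_simplyConnected [SimplyConnectedSpace D]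
    [LocallyPathConnectedSpace D] [NormalSpace D] {P Q : Set D} (hP : IsClosed P)
    (hQ : IsClosed Q) (hPc : IsPreconnected P) (hQc : IsPreconnected Q) (hPQ : P ∪ Q = univ) :
    IsPreconnected (P ∩ Q) := by
  rw [isPreconnected_closed_iff]
  rintro A₀ B₀ hA₀ hB₀ hsub ⟨a, haPQ, haA⟩ ⟨b, hbPQ, hbB⟩
  by_contra hne
  rw [not_nonempty_iff_eq_empty] at hne
  obtain ⟨f, hfA, hfB, -⟩ := exists_continuous_zero_one_of_isClosed
    ((hP.inter hQ).inter hA₀) ((hP.inter hQ).inter hB₀)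
    (disjoint_left.2 fun x hx hx' => hne.subset ⟨hx.1, hx.2, hx'.2⟩)
  classical
  have half : ((1 / 2 : ℝ) : AddCircle (1 : ℝ)) = ((-(1 / 2) : ℝ) : AddCircle (1 : ℝ)) := by
    rw [← sub_eq_zero, ← AddCircle.coe_sub, show (1 / 2 - -(1 / 2) : ℝ) = 1 by norm_num]
    exact AddCircle.coe_period 1
  -- On `P ∩ Q` the function `f` is 0 or 1, and `1/2 = -1/2` in the circle, so the two branches
  -- agree. A real lift of `u` would differ from `f/2` by a constant on `P` and from `-f/2` by a
  -- constant on `Q`, hence rise from `a` to `b` by both `1/2` and `-1/2`.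
  let u : D → AddCircle (1 : ℝ) := fun x =>
    if x ∈ P then ((f x / 2 : ℝ) : AddCircle (1 : ℝ)) else ((-(f x / 2) : ℝ) : AddCircle (1 : ℝ))
  have huP : ∀ x ∈ P, u x = ((f x / 2 : ℝ) : AddCircle (1 : ℝ)) := fun x hx => if_pos hx
  have huQ : ∀ x ∈ Q, u x = ((-(f x / 2) : ℝ) : AddCircle (1 : ℝ)) := by
    intro x hx
    by_cases hxP : x ∈ P
    · rw [huP x hxP]
      rcases hsub ⟨hxP, hx⟩ with h | h
      · rw [hfA ⟨⟨hxP, hx⟩, h⟩]; simp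
      · rw [hfB ⟨⟨hxP, hx⟩, h⟩]; exact half
    · exact if_neg hxP
  have hmk : Continuous ((↑) : ℝ → AddCircle (1 : ℝ)) := AddCircle.continuous_mk' 1
  have hu : Continuous u := by
    rw [← continuousOn_univ, ← hPQ]
    refine ContinuousOn.union_of_isClosed ?_ ?_ hP hQ
    · exact ContinuousOn.congr (by fun_prop) huP
    · exact ContinuousOn.congr (by fun_prop) huQ
  obtain ⟨θ, ⟨-, hθ⟩, -⟩ := (AddCircle.isCoveringMap_coe (1 : ℝ)).existsUnique_continuousMap_lifts
    ⟨u, hu⟩ a (f a / 2) (huP a haPQ.1).symm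
  have hθ' : ∀ x, ((θ x : ℝ) : AddCircle (1 : ℝ)) = u x := fun x => congrFun hθ x
  have hdisc : IsDiscrete (range ((↑) : ℤ → ℝ)) := by
    have := Int.isClosedEmbedding_coe_real.isEmbedding
    rw [isDiscrete_iff_discreteTopology]
    exact (this.toHomeomorph.symm).isEmbedding.discreteTopology
  have hint : ∀ r : ℝ, (r : AddCircle (1 : ℝ)) = 0 → r ∈ range ((↑) : ℤ → ℝ) := by
    intro r hr
    obtain ⟨n, hn⟩ := (AddCircle.coe_eq_zero_iff 1).1 hr
    exact ⟨n, by simpa using hn⟩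
  have e1 := hPc.constant_of_mapsTo hdisc (f := fun x => θ x - f x / 2) (by fun_prop)
    (fun x hx => hint _ (by rw [AddCircle.coe_sub, hθ', huP x hx, sub_self])) haPQ.1 hbPQ.1
  have e2 := hQc.constant_of_mapsTo hdisc (f := fun x => θ x - -(f x / 2)) (by fun_prop)
    (fun x hx => hint _ (by rw [AddCircle.coe_sub, hθ', huQ x hx, sub_self])) haPQ.2 hbPQ.2
  have fa : f a = 0 := hfA ⟨haPQ, haA⟩
  have fb : f b = 1 := hfB ⟨hbPQ, hbB⟩
  simp only [fa, fb] at e1 e2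
  linarith

end Connectedness

/-! ### Collapsing laminar families and pushing maps into `X`. -/

section Collapse

variable {D Y : Type*} [TopologicalSpace D] [TopologicalSpace Y]

/-- A map that is constant on the frontier of each member of a laminar family of open sets can be
made constant on the unions of the maximal chains of the family. -/
theorem exists_continuousMap_collapse_laminar [LocallyConnectedSpace D] [PreconnectedSpace D]
    [T2Space Y] (h : C(D, Y)) (𝓕 : Set (Set D)) (hopen : ∀ F ∈ 𝓕, IsOpen F)
    (hlam : ∀ F ∈ 𝓕, ∀ G ∈ 𝓕, F ⊆ G ∨ G ⊆ F ∨ Disjoint F G)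
    (hconst : ∀ F ∈ 𝓕, ∀ x ∈ frontier F, ∀ y ∈ frontier F, h x = h y)
    (hne : (⋃₀ 𝓕)ᶜ.Nonempty) :
    ∃ g : C(D, Y), (∀ x ∉ ⋃₀ 𝓕, g x = h x) ∧ ∀ x, g x ∈ h '' (⋃₀ 𝓕)ᶜ := by
  classical
  -- By laminarity the members through `p` form a chain, and the sets `M p` partition `⋃₀ 𝓕`. A
  -- largest member need not exist, hence the union.
  let M : D → Set D := fun p => ⋃₀ {F ∈ 𝓕 | p ∈ F}
  have hMopen : ∀ p, IsOpen (M p) := fun p => isOpen_sUnion fun F hF => hopen F hF.1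
  have hself : ∀ p ∈ ⋃₀ 𝓕, p ∈ M p := fun p ⟨F, hF, hp⟩ => ⟨F, ⟨hF, hp⟩, hp⟩
  have hMeq : ∀ p, ∀ q ∈ M p, M q = M p := by
    have key : ∀ p q, ∀ F ∈ 𝓕, p ∈ F → q ∈ F → M p ⊆ M q := by
      rintro p q F hF hp hq x ⟨G, ⟨hG, hpG⟩, hx⟩
      rcases hlam F hF G hG with h | h | h
      · exact ⟨G, ⟨hG, h hq⟩, hx⟩
      · exact ⟨F, ⟨hF, hq⟩, h hx⟩
      · exact (h.le_bot ⟨hp, hpG⟩).elim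
    rintro p q ⟨F, ⟨hF, hp⟩, hq⟩
    exact (key q p F hF hq hp).antisymm (key p q F hF hp hq)
  have hfr : ∀ p, ∀ q ∈ frontier (M p), q ∉ ⋃₀ 𝓕 := by
    rintro p q hq ⟨F, hF, hqF⟩
    rw [(hMopen p).frontier_eq] at hq
    obtain ⟨x, hxF, hxM⟩ := mem_closure_iff.1 hq.1 F (hopen F hF) hqF
    apply hq.2
    rw [← hMeq p x hxM]
    exact ⟨F, ⟨hF, hxF⟩, hqF⟩
  -- A small connected neighbourhood of a frontier point of `M p` meets the frontier of every
  -- sufficiently large member of the chain. One member `K` serves both `x` and `y`, and `h` is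
  -- constant on its frontier.
  have hMconst : ∀ p, ∀ x ∈ frontier (M p), ∀ y ∈ frontier (M p), h x = h y := by
    intro p x hx y hy
    by_contra hxy
    obtain ⟨O₁, O₂, hO₁, hO₂, hxO, hyO, hd⟩ := t2_separation hxy
    have hnear : ∀ {z : D} {O : Set Y}, IsOpen O → h z ∈ O → z ∈ frontier (M p) →
        ∃ F ∈ 𝓕, p ∈ F ∧ ∀ G ∈ 𝓕, F ⊆ G → p ∈ G → ∃ w ∈ frontier G, h w ∈ O := by
      intro z O hO hzO hz
      have hzM := hfr p z hz
      obtain ⟨B, hBsub, hBo, hzB, hBc⟩ :=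
        locallyConnectedSpace_iff_subsets_isOpen_isConnected.1 ‹_› z (h ⁻¹' O)
          ((hO.preimage h.continuous).mem_nhds hzO)
      obtain ⟨q, hqB, F, ⟨hF, hpF⟩, hqF⟩ := mem_closure_iff.1 hz.1 B hBo hzB
      refine ⟨F, hF, hpF, fun G hG hFG _ => ?_⟩
      obtain ⟨w, hwB, hw⟩ := hBc.isPreconnected.inter_frontier_nonempty (F := G)
        ⟨q, hqB, hFG hqF⟩ ⟨z, hzB, fun hzG => hzM ⟨G, hG, hzG⟩⟩
      exact ⟨w, hw, hBsub hwB⟩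
    obtain ⟨F, hF, hpF, hF'⟩ := hnear hO₁ hxO hx
    obtain ⟨G, hG, hpG, hG'⟩ := hnear hO₂ hyO hy
    obtain ⟨K, hK, hFK, hGK⟩ : ∃ K ∈ 𝓕, F ⊆ K ∧ G ⊆ K := by
      rcases hlam F hF G hG with h | h | h
      · exact ⟨G, hG, h, subset_rfl⟩
      · exact ⟨F, hF, subset_rfl, h⟩
      · exact (h.le_bot ⟨hpF, hpG⟩).elim
    obtain ⟨w, hw, hwO⟩ := hF' K hK hFK (hFK hpF)
    obtain ⟨w', hw', hwO'⟩ := hG' K hK hGK (hGK hpG)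
    exact hd.le_bot ⟨hwO, hconst K hK w hw w' hw' ▸ hwO'⟩
  have hMne : ∀ p ∈ ⋃₀ 𝓕, (frontier (M p)).Nonempty := by
    intro p hp
    refine nonempty_frontier_iff.2 ⟨⟨p, hself p hp⟩, fun h => ?_⟩
    obtain ⟨x, hx⟩ := hne
    obtain ⟨F, hF, hxF⟩ : x ∈ M p := h ▸ mem_univ x
    exact hx ⟨F, hF.1, hxF⟩
  -- The fallback `hne.some` is never reached for the sets `M p` with `p ∈ ⋃₀ 𝓕`.
  let c : Set D → D := fun A => if hA : (frontier A).Nonempty then hA.some else hne.some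
  have hc : ∀ p ∈ ⋃₀ 𝓕, c (M p) ∈ frontier (M p) := by
    intro p hp
    simp only [c, dif_pos (hMne p hp)]
    exact (hMne p hp).some_mem
  let g : D → Y := fun p => if p ∈ ⋃₀ 𝓕 then h (c (M p)) else h p
  have hg₁ : ∀ p ∈ ⋃₀ 𝓕, g p = h (c (M p)) := fun p hp => if_pos hp
  have hg₂ : ∀ p ∉ ⋃₀ 𝓕, g p = h p := fun p hp => if_neg hp
  have hMsub : ∀ p, M p ⊆ ⋃₀ 𝓕 := fun p => sUnion_mono fun F hF => hF.1
  have hcont : Continuous g := by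
    rw [continuous_iff_continuousAt]
    intro p
    by_cases hp : p ∈ ⋃₀ 𝓕
    · have : g =ᶠ[𝓝 p] fun _ => g p := by
        filter_upwards [(hMopen p).mem_nhds (hself p hp)] with q hq
        rw [hg₁ q (hMsub p hq), hg₁ p hp, hMeq p q hq]
      exact continuousAt_const.congr this.symm
    · rw [ContinuousAt, hg₂ p hp, (nhds_basis_opens (h p)).tendsto_right_iff]
      rintro O ⟨hpO, hO⟩
      obtain ⟨B, hBsub, hBo, hpB, hBc⟩ :=
        locallyConnectedSpace_iff_subsets_isOpen_isConnected.1 ‹_› p (h ⁻¹' O)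
          ((hO.preimage h.continuous).mem_nhds hpO)
      filter_upwards [hBo.mem_nhds hpB] with q hq
      by_cases hqN : q ∈ ⋃₀ 𝓕
      · obtain ⟨w, hwB, hw⟩ := hBc.isPreconnected.inter_frontier_nonempty (F := M q)
          ⟨q, hq, hself q hqN⟩ ⟨p, hpB, fun hpM => hp (hMsub q hpM)⟩
        rw [hg₁ q hqN, hMconst q _ (hc q hqN) w hw]
        exact hBsub hwB
      · rw [hg₂ q hqN]; exact hBsub hq
  refine ⟨⟨g, hcont⟩, hg₂, fun p => ?_⟩
  by_cases hp : p ∈ ⋃₀ 𝓕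
  · exact ⟨c (M p), hfr p _ (hc p hp), (hg₁ p hp).symm⟩
  · exact ⟨p, hp, (hg₂ p hp).symm⟩

/-- If every connected subset of the complement of `X` accumulates at only finitely many points of
`X`, then a map of a simply connected space can be pushed into `X` without changing it on a
connected set that is already mapped into `X`. -/
theorem exists_continuousMap_mem_of_finite_ends [SimplyConnectedSpace D]
    [LocallyPathConnectedSpace D] [LocallyConnectedSpace D] [NormalSpace D] [T2Space Y]
    (h : C(D, Y)) {X : Set Y}
    (hX : IsClosed X) (hends : ∀ T ⊆ Xᶜ, IsPreconnected T → (closure T ∩ X).Finite) {S : Set D}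
    (hS : IsPreconnected S) (hne : S.Nonempty) (hSX : ∀ s ∈ S, h s ∈ X) :
    ∃ g : C(D, Y), (∀ x, g x ∈ X) ∧ ∀ s ∈ S, g s = h s := by
  obtain ⟨s₀, hs₀⟩ := hne
  let U : Set D := h ⁻¹' Xᶜ
  have hU : IsOpen U := hX.isOpen_compl.preimage h.continuous
  let W : D → Set D := fun w => connectedComponentIn U w
  have hWo : ∀ w, IsOpen (W w) := fun w => hU.connectedComponentIn
  have hWc : ∀ w, IsPreconnected (W w) := fun w => isPreconnected_connectedComponentIn
  have hWne : ∀ w ∈ U, (W w).Nonempty := fun w hw => ⟨w, mem_connectedComponentIn hw⟩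
  have hWU : ∀ w, W w ⊆ U := fun w => connectedComponentIn_subset U w
  have hSW : ∀ w, S ⊆ (W w)ᶜ := fun w s hs hsW => hWU w hsW (hSX s hs)
  -- The hull of `W w`: everything that `W w` does not leave connected to `s₀`.
  let F : D → Set D := fun w => (connectedComponentIn (W w)ᶜ s₀)ᶜ
  have hFcl : ∀ w, IsClosed (connectedComponentIn (W w)ᶜ s₀) :=
    fun w => (hWo w).isClosed_compl.isClosed_connectedComponentIn s₀
  have hWF : ∀ w, W w ⊆ F w := fun w x hx hxC => connectedComponentIn_subset _ _ hxC hx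
  have hSF : ∀ w, ∀ s ∈ S, s ∉ F w := fun w s hs hsF =>
    hsF (hS.subset_connectedComponentIn hs₀ (hSW w) hs)
  have hFo : ∀ A ∈ F '' U, IsOpen A := by
    rintro _ ⟨w, -, rfl⟩
    exact (hFcl w).isOpen_compl
  have hlam : ∀ A ∈ F '' U, ∀ B ∈ F '' U, A ⊆ B ∨ B ⊆ A ∨ Disjoint A B := by
    rintro _ ⟨w, hw, rfl⟩ _ ⟨w', hw', rfl⟩
    by_cases hd : Disjoint (W w) (W w')
    · exact compl_connectedComponentIn_compl_nested (hWo w) (hWc w) (hWne w hw) (hWo w') (hWc w')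
        (hWne w' hw') hd (hSW w hs₀) (hSW w' hs₀)
    · obtain ⟨x, hx, hx'⟩ := not_disjoint_iff.1 hd
      have : W w = W w' := (connectedComponentIn_eq hx).trans (connectedComponentIn_eq hx').symm
      left
      simp only [F, this, subset_rfl]
  have hconst : ∀ A ∈ F '' U, ∀ x ∈ frontier A, ∀ y ∈ frontier A, h x = h y := by
    rintro _ ⟨w, hw, rfl⟩ x hx y hy
    -- Unicoherence, for the component of `s₀` and the closure of the hull: they cover `D` and meet
    -- exactly in the frontier.
    have hpre : IsPreconnected (frontier (F w)) := by
      have := isPreconnected_inter_of_simplyConnected (hFcl w) (isClosed_closure (s := F w))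
        isPreconnected_connectedComponentIn
        (isPreconnected_compl_connectedComponentIn_compl (hWo w) (hWc w) (hWne w hw) s₀).closure
        (eq_univ_of_subset (union_subset_union_right _ subset_closure) (union_compl_self _))
      rwa [(hFcl w).isOpen_compl.frontier_eq, sdiff_eq, compl_compl, inter_comm]
    have hsub : h '' frontier (F w) ⊆ closure (h '' W w) ∩ X := by
      rintro _ ⟨z, hz, rfl⟩
      have hz' := frontier_compl_connectedComponentIn_compl_subset (hWo w) s₀ hz
      rw [(hWo w).frontier_eq] at hz'
      refine ⟨image_closure_subset_closure_image h.continuous ⟨z, hz'.1, rfl⟩, ?_⟩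
      by_contra hzX
      -- If `h z` were outside `X`, adding `z` would enlarge the component `W w`.
      have hins : IsPreconnected (insert z (W w)) :=
        (hWc w).subset_closure (subset_insert z _) (insert_subset hz'.1 subset_closure)
      exact hz'.2 (hins.subset_connectedComponentIn
        (mem_insert_of_mem z (mem_connectedComponentIn hw)) (insert_subset hzX (hWU w))
        (mem_insert z _))
    have hfin := (hends _ (image_subset_iff.2 (hWU w))
      ((hWc w).image h h.continuous.continuousOn)).subset hsub
    exact not_nontrivial_iff.1
      (fun hnt => (hpre.image h h.continuous.continuousOn).infinite_of_nontrivial hnt hfin)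
      ⟨x, hx, rfl⟩ ⟨y, hy, rfl⟩
  obtain ⟨g, hg₁, hg₂⟩ := exists_continuousMap_collapse_laminar h (F '' U) hFo hlam hconst
    ⟨s₀, by rintro ⟨_, ⟨w, -, rfl⟩, hs⟩; exact hSF w s₀ hs₀ hs⟩
  refine ⟨g, fun x => ?_, fun s hs => hg₁ s ?_⟩
  · obtain ⟨p, hp, hpx⟩ := hg₂ x
    rw [← hpx]
    by_contra hpX
    exact hp ⟨F p, ⟨p, hpX, rfl⟩, hWF p (mem_connectedComponentIn hpX)⟩
  · rintro ⟨_, ⟨w, -, rfl⟩, hsF⟩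
    exact hSF w s hs hsF

end Collapse

/-! ### Wild points off `X`, `π₁`-injectivity, and essential spheres. -/

section Injectivity

theorem Topology.IsEmbedding.exists_continuousMap_lift {A Z Y : Type*} [TopologicalSpace A]
    [TopologicalSpace Z] [TopologicalSpace Y] {m : C(Z, Y)} (hm : IsEmbedding m) (f : C(A, Y))
    (hf : ∀ a, f a ∈ range m) : ∃ k : C(A, Z), m.comp k = f := by
  choose k hk using hf
  exact ⟨⟨k, hm.continuous_iff.2 (by
    rw [show m ∘ k = f from funext hk]; exact f.continuous)⟩,
    ContinuousMap.ext hk⟩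

variable {X Y : Type u} [TopologicalSpace X] [TopologicalSpace Y]

/-- An arc of `Sᶜ` is open in `Y`, so a map of the earring based in it sends almost all spheres into
it, where they contract. -/
theorem wildSet_subset_of_openArcs (n : ℕ) {S : Set Y} (hS : IsClosed S)
    (h : IsCountableDisjointUnionOfOpenArcs Sᶜ) : wildSet n Y ⊆ S := by
  rintro _ ⟨f, rfl, hf⟩
  by_contra hy
  obtain ⟨ι, -, ⟨e⟩⟩ := h
  let c : ι := (e ⟨_, hy⟩).1
  let m : C(Ioo (0 : ℝ) 1, Y) := ⟨fun t => (e.symm ⟨c, t⟩ : Y),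
    continuous_subtype_val.comp (e.symm.continuous.comp continuous_sigmaMk)⟩
  have hm : IsOpenEmbedding m := hS.isOpen_compl.isOpenEmbedding_subtypeVal.comp
    (e.symm.isOpenEmbedding.comp Topology.IsOpenEmbedding.sigmaMk)
  have hopen : IsOpen (f ⁻¹' range m) := hm.isOpen_range.preimage f.continuous
  have hfin := hopen.2 (by
    refine ⟨(e ⟨_, hy⟩).2, ?_⟩
    simp only [m, c, ContinuousMap.coe_mk, Sigma.eta, e.symm_apply_apply]
    rfl)
  obtain ⟨j, hj⟩ := hfin.infinite_compl.nonempty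
  simp only [mem_compl_iff, mem_ofPred_eq, not_not] at hj
  obtain ⟨k, hk⟩ := hm.isEmbedding.exists_continuousMap_lift (f.comp (Earring.sphereIncl n j))
    (fun a => hj ⟨a, rfl⟩)
  apply hf j
  rw [← hk]
  have : ContractibleSpace (Ioo (0 : ℝ) 1) :=
    (convex_Ioo 0 1).contractibleSpace (nonempty_Ioo.2 zero_lt_one)
  exact ((id_nullhomotopic _).comp_right m).comp_left k

variable [T2Space Y]

theorem isPiOneInjective_of_finite_ends {i : C(X, Y)} (hi : IsClosedEmbedding i)
    (hends : ∀ T ⊆ (range i)ᶜ, IsPreconnected T → (closure T ∩ range i).Finite) :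
    IsPiOneInjective i := by
  intro x a b hab
  induction a using Quotient.inductionOn with | _ p
  induction b using Quotient.inductionOn with | _ q
  have hab' : (p.map i.continuous).Homotopic (q.map i.continuous) := Quotient.exact hab
  obtain ⟨H⟩ := hab'
  let pr : ℝ → unitInterval := projIcc 0 1 zero_le_one
  have hpr : Continuous pr := continuous_projIcc
  -- Clamping extends the homotopy from the square to the plane; in the sup norm the boundary of the
  -- square is the sphere `S`.
  let h : C(ℝ × ℝ, Y) := ⟨fun z => H (pr z.1, pr z.2), by fun_prop⟩
  let S : Set (ℝ × ℝ) := Metric.sphere ((1 / 2, 1 / 2) : ℝ × ℝ) (1 / 2)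
  have hSc : IsConnected S := isConnected_sphere (by simp; norm_num) _ (by norm_num)
  have hS : ∀ s t : unitInterval, s = 0 ∨ s = 1 ∨ t = 0 ∨ t = 1 → ((s : ℝ), (t : ℝ)) ∈ S := by
    intro s t hst
    have h1 := s.2.1
    have h2 := s.2.2
    have h3 := t.2.1
    have h4 := t.2.2
    simp only [S, mem_sphere_iff_norm, Prod.mk_sub_mk, Prod.norm_mk, Real.norm_eq_abs]
    have e1 : |(s : ℝ) - 1 / 2| ≤ 1 / 2 := abs_le.2 ⟨by linarith, by linarith⟩
    have e2 : |(t : ℝ) - 1 / 2| ≤ 1 / 2 := abs_le.2 ⟨by linarith, by linarith⟩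
    rcases hst with rfl | rfl | rfl | rfl
    · exact (max_eq_left (e2.trans (by norm_num))).trans (by norm_num)
    · exact (max_eq_left (e2.trans (by norm_num))).trans (by norm_num)
    · exact (max_eq_right (e1.trans (by norm_num))).trans (by norm_num)
    · exact (max_eq_right (e1.trans (by norm_num))).trans (by norm_num)
  have hval : ∀ s t : unitInterval, h ((s : ℝ), (t : ℝ)) = H (s, t) := fun s t => by
    simp [h, pr, projIcc_val]
  have hSX : ∀ z ∈ S, h z ∈ range i := by
    rintro ⟨s, t⟩ hz
    simp only [S, mem_sphere_iff_norm, Prod.mk_sub_mk, Prod.norm_mk, Real.norm_eq_abs] at hz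
    have e1 : |s - 1 / 2| ≤ 1 / 2 := (le_max_left _ _).trans hz.le
    have e2 : |t - 1 / 2| ≤ 1 / 2 := (le_max_right _ _).trans hz.le
    rw [abs_le] at e1 e2
    lift s to unitInterval using ⟨by linarith, by linarith⟩
    lift t to unitInterval using ⟨by linarith, by linarith⟩
    rw [hval]
    have h4 : s = 0 ∨ s = 1 ∨ t = 0 ∨ t = 1 := by
      rcases max_choice |(s : ℝ) - 1 / 2| |(t : ℝ) - 1 / 2| with h | h <;> rw [h] at hz <;>
        rcases abs_eq (by norm_num : (0 : ℝ) ≤ 1 / 2) |>.1 hz with h' | h'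
      · exact .inr (.inl (Subtype.ext (show (s : ℝ) = 1 by linarith)))
      · exact .inl (Subtype.ext (show (s : ℝ) = 0 by linarith))
      · exact .inr (.inr (.inr (Subtype.ext (show (t : ℝ) = 1 by linarith))))
      · exact .inr (.inr (.inl (Subtype.ext (show (t : ℝ) = 0 by linarith))))
    rcases h4 with rfl | rfl | rfl | rfl
    · exact ⟨p t, by simp⟩
    · exact ⟨q t, by simp⟩
    · exact ⟨x, by simp⟩
    · exact ⟨x, by simp⟩
  obtain ⟨g, hgX, hgS⟩ := exists_continuousMap_mem_of_finite_ends h hi.isClosed_range hends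
    hSc.isPreconnected hSc.nonempty hSX
  obtain ⟨G, hG⟩ := hi.isEmbedding.exists_continuousMap_lift g hgX
  have hGS : ∀ s t : unitInterval, s = 0 ∨ s = 1 ∨ t = 0 ∨ t = 1 →
      i (G ((s : ℝ), (t : ℝ))) = H (s, t) := fun s t hst => by
    rw [← hval, ← hgS _ (hS s t hst), ← hG]; rfl
  refine Quotient.sound ⟨⟨⟨⟨fun z => G ((z.1 : ℝ), (z.2 : ℝ)), by fun_prop⟩, fun t => ?_,
    fun t => ?_⟩, fun s t ht => ?_⟩⟩
  · exact hi.injective ((hGS 0 t (by simp)).trans (by simp))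
  · exact hi.injective ((hGS 1 t (by simp)).trans (by simp))
  · rcases ht with rfl | rfl
    · exact hi.injective ((hGS s 0 (by simp)).trans (by simp))
    · exact hi.injective ((hGS s 1 (by simp)).trans (by simp))

theorem nullhomotopic_of_comp_of_finite_ends {n : ℕ} (hn : 1 ≤ n) {i : C(X, Y)}
    (hi : IsClosedEmbedding i)
    (hends : ∀ T ⊆ (range i)ᶜ, IsPreconnected T → (closure T ∩ range i).Finite)
    {f : C(NSphere n, X)} (hf : (i.comp f).Nullhomotopic) : f.Nullhomotopic := by
  obtain ⟨y, ⟨H⟩⟩ := hf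
  let E := EuclideanSpace ℝ (Fin (n + 1))
  let pr : ℝ → unitInterval := projIcc 0 1 zero_le_one
  have hpr : Continuous pr := continuous_projIcc
  classical
  let dir : E → NSphere n := fun v => if hv : v = 0 then NSphere.base n else
    ⟨‖v‖⁻¹ • v, by
      rw [mem_sphere_zero_iff_norm, norm_smul, norm_inv, norm_norm,
        inv_mul_cancel₀ (norm_ne_zero_iff.2 hv)]⟩
  have hdir : ContinuousOn dir {v | 1 / 2 ≤ ‖v‖} := by
    have hne : ∀ v ∈ {v : E | 1 / 2 ≤ ‖v‖}, v ≠ 0 := by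
      rintro v hv rfl
      simp only [mem_ofPred_eq, norm_zero] at hv
      norm_num at hv
    rw [Topology.IsInducing.subtypeVal.continuousOn_iff]
    refine ContinuousOn.congr (f := fun v : E => ‖v‖⁻¹ • v) ?_ fun v hv => by
      simp [dir, hne v hv]
    exact (continuousOn_id.norm.inv₀ fun v hv => norm_ne_zero_iff.2 (hne v hv)).smul continuousOn_id
  -- Time runs from 0 at norm 1 to 1 at norm `1/2`. Further in, the value is constantly `y`, so the
  -- discontinuity of `dir` at the origin does no harm.
  let hfun : E → Y := fun v => H (pr (2 - 2 * ‖v‖), dir v)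
  have hc : Continuous hfun := by
    rw [← continuousOn_univ,
      show (univ : Set E) = {v | ‖v‖ ≤ 1 / 2} ∪ {v | 1 / 2 ≤ ‖v‖} from
        (eq_univ_of_forall fun v : E => (le_total ‖v‖ (1 / 2) : _)).symm]
    refine ContinuousOn.union_of_isClosed ?_ ?_ (isClosed_le continuous_norm continuous_const)
      (isClosed_le continuous_const continuous_norm)
    · refine ContinuousOn.congr (f := fun _ => y) continuousOn_const fun v hv => ?_
      have : pr (2 - 2 * ‖v‖) = 1 :=
        projIcc_of_right_le _ (by have : ‖v‖ ≤ 1 / 2 := hv; linarith)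
      simp [hfun, this]
    · exact H.continuous.comp_continuousOn
        (ContinuousOn.prodMk (by fun_prop) hdir)
  have hval : ∀ v : NSphere n, hfun v = i (f v) := by
    intro v
    have hv : ‖(v : E)‖ = 1 := by simp
    have hv0 : (v : E) ≠ 0 := fun h => by simp [h] at hv
    have h1 : pr (2 - 2 * ‖(v : E)‖) = 0 := by
      rw [hv]; exact projIcc_of_le_left _ (by norm_num)
    have h2 : dir v = v := Subtype.ext (by simp [dir, hv0, hv])
    simp only [hfun, h1, h2, H.apply_zero, ContinuousMap.comp_apply]
  have hSc : IsConnected (Metric.sphere (0 : E) 1) :=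
    isConnected_sphere (by
      rw [← Module.finrank_eq_rank, finrank_euclideanSpace_fin]; exact_mod_cast Nat.lt_succ_of_le hn)
      _ zero_le_one
  obtain ⟨g, hgX, hgS⟩ := exists_continuousMap_mem_of_finite_ends ⟨hfun, hc⟩ hi.isClosed_range hends
    hSc.isPreconnected hSc.nonempty (fun v hv => ⟨f ⟨v, hv⟩, (hval ⟨v, hv⟩).symm⟩)
  obtain ⟨G, hG⟩ := hi.isEmbedding.exists_continuousMap_lift g hgX
  have hGf : f = (G.comp (ContinuousMap.id E)).comp ⟨Subtype.val, continuous_subtype_val⟩ := by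
    ext v
    apply hi.injective
    rw [← hval v]
    exact (hgS v v.2).symm.trans (by rw [← hG]; rfl)
  rw [hGf]
  exact ((id_nullhomotopic E).comp_right G).comp_left _

theorem image_wildSet_subset_of_finite_ends {n : ℕ} (hn : 1 ≤ n) {i : C(X, Y)}
    (hi : IsClosedEmbedding i)
    (hends : ∀ T ⊆ (range i)ᶜ, IsPreconnected T → (closure T ∩ range i).Finite) :
    i '' wildSet n X ⊆ wildSet n Y := by
  rintro _ ⟨x, ⟨f, rfl, hf⟩, rfl⟩
  exact ⟨i.comp f, rfl, fun j hj => hf j (nullhomotopic_of_comp_of_finite_ends hn hi hends hj)⟩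

end Injectivity

/-! ### Covering dimension. -/

section CoveringDimension

theorem HasCoveringDimLE.mono {X : Type u} [TopologicalSpace X] {d d' : WithBot ℕ∞}
    (h : HasCoveringDimLE X d) (hd : d ≤ d') : HasCoveringDimLE X d' := by
  intro 𝒰 h₁ h₂ h₃
  obtain ⟨𝒱, h₄, h₅, h₆, h₇, h₈⟩ := h 𝒰 h₁ h₂ h₃
  exact ⟨𝒱, h₄, h₅, h₆, h₇, fun x => (h₈ x).trans (by gcongr)⟩

/-- The infimum is attained because `WithBot ℕ∞` is well-ordered and `⊤` is always a bound. -/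
theorem hasCoveringDimLE_coveringDim (X : Type u) [TopologicalSpace X] :
    HasCoveringDimLE X (coveringDim X) :=
  csInf_mem (s := {d : WithBot ℕ∞ | HasCoveringDimLE X d})
    ⟨⊤, fun 𝒰 h₁ h₂ h₃ => ⟨𝒰, h₁, h₂, h₃, fun V hV => ⟨V, hV, subset_rfl⟩, fun _ => le_top⟩⟩

/-- Assign each member of a refinement to one index and take unions; this cannot raise the order. -/
theorem HasCoveringDimLE.exists_shrinking {X : Type u} [TopologicalSpace X] {d : WithBot ℕ∞}
    (h : HasCoveringDimLE X d) {ι : Type*} [Finite ι] (U : ι → Set X) (hU : ∀ k, IsOpen (U k))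
    (hcov : ⋃ k, U k = univ) :
    ∃ V : ι → Set X, (∀ k, IsOpen (V k)) ∧ (∀ k, V k ⊆ U k) ∧ ⋃ k, V k = univ ∧
      ∀ x, (({k | x ∈ V k}.encard : ℕ∞) : WithBot ℕ∞) ≤ d + 1 := by
  obtain ⟨𝒱, -, hVo, hVc, hVU, hVd⟩ := h (range U) (finite_range U)
    (by rintro _ ⟨k, rfl⟩; exact hU k) (by rwa [sUnion_range])
  have hex : ∀ V : 𝒱, ∃ k, (V : Set X) ⊆ U k := by
    rintro ⟨V, hV⟩
    obtain ⟨_, ⟨k, rfl⟩, hk⟩ := hVU V hV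
    exact ⟨k, hk⟩
  choose c hc using hex
  refine ⟨fun k => ⋃ (V : 𝒱) (_ : c V = k), V, fun k => ?_, fun k => ?_, ?_, fun x => ?_⟩
  · exact isOpen_iUnion fun V => isOpen_iUnion fun _ => hVo V V.2
  · exact iUnion_subset fun V => iUnion_subset fun hV => hV ▸ hc V
  · refine eq_univ_of_forall fun x => ?_
    obtain ⟨V, hV, hx⟩ : x ∈ ⋃₀ 𝒱 := hVc ▸ mem_univ x
    simp only [mem_iUnion]
    exact ⟨c ⟨V, hV⟩, ⟨V, hV⟩, rfl, hx⟩
  · refine le_trans (WithBot.coe_le_coe.2 ?_) (hVd x)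
    have hsub : {k | x ∈ ⋃ (V : 𝒱) (_ : c V = k), (V : Set X)} ⊆ c '' {V : 𝒱 | x ∈ (V : Set X)} := by
      intro k hk
      simp only [mem_ofPred_eq, mem_iUnion] at hk
      obtain ⟨V, hV, hx⟩ := hk
      exact ⟨V, hx, hV⟩
    refine (encard_le_encard hsub).trans ((encard_image_le _ _).trans ?_)
    refine encard_le_encard_of_injOn (f := Subtype.val) (fun V hV => ⟨V.2, hV⟩)
      Subtype.val_injective.injOn

theorem HasCoveringDimLE.of_exists_shrinking {X : Type u} [TopologicalSpace X] {d : WithBot ℕ∞}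
    (h : ∀ (ι : Type u) [Finite ι] (U : ι → Set X), (∀ k, IsOpen (U k)) → ⋃ k, U k = univ →
      ∃ V : ι → Set X, (∀ k, IsOpen (V k)) ∧ (∀ k, V k ⊆ U k) ∧ ⋃ k, V k = univ ∧
        ∀ x, (({k | x ∈ V k}.encard : ℕ∞) : WithBot ℕ∞) ≤ d + 1) : HasCoveringDimLE X d := by
  intro 𝒰 h₁ h₂ h₃
  have := h₁.to_subtype
  obtain ⟨V, hVo, hVU, hVc, hVd⟩ := h 𝒰 (fun U => U) (fun U => h₂ U U.2)
    (by rwa [← sUnion_eq_iUnion])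
  refine ⟨range V, finite_range V, ?_, by rwa [sUnion_range], ?_, fun x => ?_⟩
  · rintro _ ⟨k, rfl⟩; exact hVo k
  · rintro _ ⟨k, rfl⟩; exact ⟨k, k.2, hVU k⟩
  · refine le_trans (WithBot.coe_le_coe.2 ?_) (hVd x)
    refine le_trans (encard_le_encard ?_) (encard_image_le V _)
    rintro _ ⟨⟨k, rfl⟩, hx⟩
    exact ⟨k, hx, rfl⟩

theorem HasCoveringDimLE.of_isClosedEmbedding {A : Type*} {Y : Type*} [TopologicalSpace A]
    [TopologicalSpace Y] {d : WithBot ℕ∞} (h : HasCoveringDimLE Y d) {i : A → Y}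
    (hi : IsClosedEmbedding i) : HasCoveringDimLE A d := by
  refine .of_exists_shrinking fun ι _ U hU hcov => ?_
  obtain ⟨V, hVo, hVU, hVc, hVd⟩ := h.exists_shrinking
    (fun k : Option ι => k.elim (range i)ᶜ fun k => (i '' (U k)ᶜ)ᶜ)
    (by
      rintro (_ | k)
      · exact hi.isClosed_range.isOpen_compl
      · exact (hi.isClosedMap _ (hU k).isClosed_compl).isOpen_compl)
    (by
      refine eq_univ_of_forall fun y => ?_
      by_cases hy : y ∈ range i
      · obtain ⟨a, rfl⟩ := hy
        obtain ⟨k, hk⟩ := mem_iUnion.1 (hcov ▸ mem_univ a)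
        refine mem_iUnion.2 ⟨some k, ?_⟩
        rintro ⟨b, hb, hba⟩
        exact hb (hi.injective hba ▸ hk)
      · exact mem_iUnion.2 ⟨none, hy⟩)
  refine ⟨fun k => i ⁻¹' V (some k), fun k => (hVo _).preimage hi.continuous, fun k a ha => ?_, ?_,
    fun a => ?_⟩
  · by_contra hak
    exact hVU (some k) ha ⟨a, hak, rfl⟩
  · refine eq_univ_of_forall fun a => ?_
    obtain ⟨k, hk⟩ := mem_iUnion.1 (hVc ▸ mem_univ (i a))
    rcases k with _ | k
    · exact (hVU none hk ⟨a, rfl⟩).elim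
    · exact mem_iUnion.2 ⟨k, hk⟩
  · refine le_trans (WithBot.coe_le_coe.2 ?_) (hVd (i a))
    exact encard_le_encard_of_injOn (f := some) (fun k hk => hk) (Option.some_injective ι).injOn

/-- An open cover can be shrunk so as to have small order along a closed subspace. -/
theorem HasCoveringDimLE.exists_shrinking_of_isClosedEmbedding {A : Type*} {Y : Type*}
    [TopologicalSpace A] [TopologicalSpace Y] {d : WithBot ℕ∞} (h : HasCoveringDimLE A d)
    {i : A → Y} (hi : IsClosedEmbedding i) {ι : Type*} [Finite ι] (U : ι → Set Y)
    (hU : ∀ k, IsOpen (U k)) (hcov : ⋃ k, U k = univ) :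
    ∃ V : ι → Set Y, (∀ k, IsOpen (V k)) ∧ (∀ k, V k ⊆ U k) ∧ ⋃ k, V k = univ ∧
      ∀ a, (({k | i a ∈ V k}.encard : ℕ∞) : WithBot ℕ∞) ≤ d + 1 := by
  obtain ⟨V, hVo, hVU, hVc, hVd⟩ := h.exists_shrinking (fun k => i ⁻¹' U k)
    (fun k => (hU k).preimage hi.continuous) (by rw [← preimage_iUnion, hcov, preimage_univ])
  refine ⟨fun k => U k \ i '' (V k)ᶜ, fun k => (hU k).sdiff (hi.isClosedMap _ (hVo k).isClosed_compl),
    fun k => sdiff_subset, eq_univ_of_forall fun y => ?_, fun a => ?_⟩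
  · by_cases hy : y ∈ range i
    · obtain ⟨a, rfl⟩ := hy
      obtain ⟨k, hk⟩ := mem_iUnion.1 (hVc ▸ mem_univ a)
      refine mem_iUnion.2 ⟨k, hVU k hk, ?_⟩
      rintro ⟨b, hb, hba⟩
      exact hb (hi.injective hba ▸ hk)
    · obtain ⟨k, hk⟩ := mem_iUnion.1 (hcov ▸ mem_univ y)
      exact mem_iUnion.2 ⟨k, hk, fun ⟨a, _, ha⟩ => hy ⟨a, ha⟩⟩
  · refine le_trans (WithBot.coe_le_coe.2 (encard_le_encard fun k hk => ?_)) (hVd a)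
    by_contra hak
    exact hk.2 ⟨a, hak, rfl⟩

/-- A normal space has covering dimension at most `d` if this holds for a closed subspace and for
all closed sets disjoint from it. -/
theorem hasCoveringDimLE_of_closed_of_disjoint_closed {X : Type*} {Y : Type u} [TopologicalSpace X]
    [TopologicalSpace Y] [NormalSpace Y] {d : WithBot ℕ∞} {i : X → Y} (hi : IsClosedEmbedding i)
    (hX : HasCoveringDimLE X d)
    (hK : ∀ K : Set Y, IsClosed K → K ⊆ (range i)ᶜ → HasCoveringDimLE K d) :
    HasCoveringDimLE Y d := by
  refine .of_exists_shrinking fun ι _ U hU hcov => ?_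
  obtain ⟨G, hGo, hGU, hGc, hGd⟩ := hX.exists_shrinking_of_isClosedEmbedding hi U hU hcov
  obtain ⟨H, hHc, hHo, hHG⟩ := exists_iUnion_eq_closure_subset hGo (fun _ => toFinite _) hGc
  -- Passing to closures makes the set of good points open. The bad points then form a closed set
  -- off `X`, and a second shrinking along it leaves the order on `O` no larger.
  let O : Set Y := {y | (({k | y ∈ closure (H k)}.encard : ℕ∞) : WithBot ℕ∞) ≤ d + 1}
  have hO : IsOpen O := by
    rw [isOpen_iff_mem_nhds]
    intro y hy
    have : ⋂ k ∈ {k | y ∉ closure (H k)}, (closure (H k))ᶜ ∈ 𝓝 y :=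
      (Filter.biInter_mem (toFinite _)).2 fun k hk => isClosed_closure.isOpen_compl.mem_nhds hk
    filter_upwards [this] with z hz
    refine le_trans (WithBot.coe_le_coe.2 (encard_le_encard fun k hk => ?_)) hy
    by_contra hyk
    exact mem_iInter₂.1 hz k hyk hk
  have hXO : range i ⊆ O := by
    rintro _ ⟨x, rfl⟩
    exact le_trans (WithBot.coe_le_coe.2 (encard_le_encard fun k hk => hHG k hk)) (hGd x)
  obtain ⟨V, hVo, hVH, hVc, hVd⟩ :=
    (hK Oᶜ hO.isClosed_compl (compl_subset_compl.2 hXO)).exists_shrinking_of_isClosedEmbedding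
      hO.isClosed_compl.isClosedEmbedding_subtypeVal H hHo hHc
  refine ⟨V, hVo, fun k => (hVH k).trans (subset_closure.trans ((hHG k).trans (hGU k))), hVc,
    fun y => ?_⟩
  by_cases hy : y ∈ O
  · exact le_trans (WithBot.coe_le_coe.2 (encard_le_encard
      fun k (hk : y ∈ V k) => (subset_closure (hVH k hk) : y ∈ closure (H k)))) hy
  · exact hVd ⟨y, hy⟩

theorem hasCoveringDimLE_unitInterval : HasCoveringDimLE unitInterval 1 := by
  intro 𝒰 hfin hopen hcov
  obtain ⟨δ, hδ, hball⟩ := lebesgue_number_lemma_of_metric_sUnion isCompact_univ hopen hcov.ge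
  obtain ⟨N, hN⟩ := exists_nat_gt (1 / δ)
  have hN0 : (0 : ℝ) < N := (by positivity : (0 : ℝ) < 1 / δ).trans hN
  have hNδ : 1 / (N : ℝ) < δ := by rwa [one_div_lt hN0 hδ]
  -- Intervals of radius `1/N < δ` about `k/N`; only the two indices around `N * x` can contain `x`.
  let V : ℕ → Set unitInterval := fun k => {x | |(N : ℝ) * x - k| < 1}
  refine ⟨V '' Iic N, (finite_Iic N).image V, ?_, ?_, ?_, fun x => ?_⟩
  · rintro _ ⟨k, -, rfl⟩
    exact isOpen_lt (by fun_prop) continuous_const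
  · refine eq_univ_of_forall fun x => ⟨V ⌊(N : ℝ) * x⌋₊, ⟨_, ?_, rfl⟩, ?_⟩
    · refine Nat.floor_le_of_le ?_
      exact mul_le_of_le_one_right hN0.le x.2.2
    · have h1 := Nat.floor_le (mul_nonneg hN0.le x.2.1)
      have h2 := Nat.lt_floor_add_one ((N : ℝ) * x)
      show |(N : ℝ) * x - ⌊(N : ℝ) * x⌋₊| < 1
      exact abs_lt.2 ⟨by linarith, by linarith⟩
  · rintro _ ⟨k, hk, rfl⟩
    have hk' : (k : ℝ) / N ∈ unitInterval :=
      ⟨by positivity, (div_le_one hN0).2 (by exact_mod_cast hk)⟩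
    obtain ⟨U, hU, hUb⟩ := hball ⟨_, hk'⟩ (mem_univ _)
    refine ⟨U, hU, fun x hx => hUb ?_⟩
    have hx' : |(N : ℝ) * x - k| < 1 := hx
    rw [Metric.mem_ball, Subtype.dist_eq, Real.dist_eq]
    calc |(x : ℝ) - k / N| = |(N : ℝ) * x - k| / N := by
          rw [eq_div_iff hN0.ne', ← abs_of_pos hN0, ← abs_mul, abs_of_pos hN0]
          congr 1
          field_simp
      _ < 1 / N := by gcongr
      _ < δ := hNδ
  · have hsub : {A ∈ V '' Iic N | x ∈ A} ⊆ {V ⌊(N : ℝ) * x⌋₊, V (⌊(N : ℝ) * x⌋₊ + 1)} := by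
      rintro _ ⟨⟨k, -, rfl⟩, hk⟩
      have hk' : |(N : ℝ) * x - k| < 1 := hk
      rw [abs_lt] at hk'
      have h1 := Nat.floor_le (mul_nonneg hN0.le x.2.1)
      have h2 := Nat.lt_floor_add_one ((N : ℝ) * x)
      have h3 : k < ⌊(N : ℝ) * x⌋₊ + 2 := by
        have : (k : ℝ) < ⌊(N : ℝ) * x⌋₊ + 2 := by linarith
        exact_mod_cast this
      have h4 : ⌊(N : ℝ) * x⌋₊ < k + 1 := by
        have : (⌊(N : ℝ) * x⌋₊ : ℝ) < k + 1 := by linarith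
        exact_mod_cast this
      obtain h | h : k = ⌊(N : ℝ) * x⌋₊ ∨ k = ⌊(N : ℝ) * x⌋₊ + 1 := by omega
      · exact .inl (by rw [h])
      · exact .inr (by rw [h]; rfl)
    have h2 := (encard_le_encard hsub).trans (encard_insert_le _ _)
    rw [encard_singleton] at h2
    exact WithBot.coe_le_coe.2 h2

/-- In dimension below 1, distinct members of the refinement of `{{p}ᶜ, {q}ᶜ}` are disjoint, so the
one containing `p` is clopen, hence all of `Y`. -/
theorem HasCoveringDimLE.one_le {Y : Type u} [TopologicalSpace Y] [T1Space Y] [ConnectedSpace Y]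
    [Nontrivial Y] {d : WithBot ℕ∞} (h : HasCoveringDimLE Y d) : 1 ≤ d := by
  by_contra hd
  obtain ⟨p, q, hpq⟩ := exists_pair_ne Y
  obtain ⟨𝒱, hfin, hVo, hVc, hVU, hVd⟩ := h {{p}ᶜ, {q}ᶜ} (toFinite _)
    (by rintro U (rfl | rfl) <;> exact isOpen_compl_singleton)
    (by
      refine eq_univ_of_forall fun x => ?_
      by_cases hx : x = p
      · exact ⟨{q}ᶜ, by simp, fun h => hpq (hx.symm.trans h)⟩
      · exact ⟨{p}ᶜ, by simp, hx⟩)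
  have hd1 : d + 1 ≤ ((1 : ℕ∞) : WithBot ℕ∞) := by
    rcases d with _ | d
    · exact bot_le
    · have hd' : ¬ (1 : ℕ∞) ≤ d := fun h => hd (WithBot.coe_le_coe.2 h)
      rw [Order.one_le_iff_ne_zero, not_not] at hd'
      subst hd'
      exact le_rfl
  have huniq : ∀ x, ∀ A ∈ 𝒱, ∀ B ∈ 𝒱, x ∈ A → x ∈ B → A = B := by
    intro x A hA B hB hxA hxB
    exact encard_le_one_iff.1 (WithBot.coe_le_coe.1 ((hVd x).trans hd1)) A B ⟨hA, hxA⟩ ⟨hB, hxB⟩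
  obtain ⟨A, hA, hpA⟩ : p ∈ ⋃₀ 𝒱 := hVc ▸ mem_univ p
  have hAcl : IsClosed A := by
    have : Aᶜ = ⋃₀ (𝒱 \ {A}) := by
      ext x
      constructor
      · intro hx
        obtain ⟨B, hB, hxB⟩ : x ∈ ⋃₀ 𝒱 := hVc ▸ mem_univ x
        exact ⟨B, ⟨hB, fun h => hx (mem_singleton_iff.1 h ▸ hxB)⟩, hxB⟩
      · rintro ⟨B, ⟨hB, hBA⟩, hxB⟩ hxA
        exact hBA (huniq x B hB A hA hxB hxA)
    rw [← isOpen_compl_iff, this]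
    exact isOpen_sUnion fun B hB => hVo B hB.1
  have hAu := IsClopen.eq_univ ⟨hAcl, hVo A hA⟩ ⟨p, hpA⟩
  obtain ⟨U, rfl | rfl, hAU⟩ := hVU A hA
  · exact hAU hpA rfl
  · exact hAU (hAu ▸ mem_univ q) rfl

end CoveringDimension

/-! ### Bounded open subsets of the line. -/

section OpenArcs

theorem exists_eq_Ioo_of_isOpen_of_isConnected {c : Set ℝ} (hc : IsConnected c) (ho : IsOpen c)
    (hb : Bornology.IsBounded c) : ∃ a b, a < b ∧ c = Ioo a b := by
  have hsub : c ⊆ Ioo (sInf c) (sSup c) := by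
    intro x hx
    obtain ⟨ε, hε, hball⟩ := Metric.isOpen_iff.1 ho x hx
    have h1 : x - ε / 2 ∈ c := hball (by
      rw [Metric.mem_ball, Real.dist_eq, abs_lt]; constructor <;> linarith)
    have h2 : x + ε / 2 ∈ c := hball (by
      rw [Metric.mem_ball, Real.dist_eq, abs_lt]; constructor <;> linarith)
    have h3 := csInf_le hb.bddBelow h1
    have h4 := le_csSup hb.bddAbove h2
    exact ⟨by linarith, by linarith⟩
  obtain ⟨x, hx⟩ := hc.nonempty
  exact ⟨_, _, (hsub hx).1.trans (hsub hx).2,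
    hsub.antisymm (hc.Ioo_csInf_csSup_subset hb.bddBelow hb.bddAbove)⟩

/-- A bounded open set of reals is a countable disjoint union of open arcs. -/
theorem isCountableDisjointUnionOfOpenArcs_of_isOpen {U : Set ℝ} (hU : IsOpen U)
    (hb : Bornology.IsBounded U) : IsCountableDisjointUnionOfOpenArcs U := by
  let ι : Set (Set ℝ) := {c | ∃ x ∈ U, c = connectedComponentIn U x}
  have hsub : ∀ c ∈ ι, c ⊆ U := by
    rintro _ ⟨x, -, rfl⟩; exact connectedComponentIn_subset _ _
  have hopen : ∀ c ∈ ι, IsOpen c := by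
    rintro _ ⟨x, -, rfl⟩; exact hU.connectedComponentIn
  have hconn : ∀ c ∈ ι, IsConnected c := by
    rintro _ ⟨x, hx, rfl⟩; exact isConnected_connectedComponentIn_iff.2 hx
  have heq : ∀ c ∈ ι, ∀ c' ∈ ι, ∀ x, x ∈ c → x ∈ c' → c = c' := by
    rintro _ ⟨y, -, rfl⟩ _ ⟨y', -, rfl⟩ x hx hx'
    exact (connectedComponentIn_eq hx).trans (connectedComponentIn_eq hx').symm
  have hcount : ι.Countable := by
    refine PairwiseDisjoint.countable_of_isOpen (s := id) ?_ hopen fun c hc => (hconn c hc).nonempty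
    intro c hc c' hc' hne
    exact disjoint_left.2 fun x hx hx' => hne (heq c hc c' hc' x hx hx')
  have hIoo : ∀ c : ι, ∃ a b : ℝ, a < b ∧ (c : Set ℝ) = Ioo a b := fun c =>
    exists_eq_Ioo_of_isOpen_of_isConnected (hconn c c.2) (hopen c c.2) (hb.subset (hsub c c.2))
  choose a b hab hc using hIoo
  let m : ι → Ioo (0 : ℝ) 1 → ℝ := fun c t => (b c - a c) * t + a c
  have hm : ∀ c, IsOpenEmbedding (m c) := fun c =>
    (affineHomeomorph (b c - a c) (a c) (sub_pos.2 (hab c)).ne').isOpenEmbedding.comp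
      isOpen_Ioo.isOpenEmbedding_subtypeVal
  have hmem : ∀ (c : ι) t, m c t ∈ (c : Set ℝ) := by
    intro c t
    rw [hc c]
    have h := sub_pos.2 (hab c)
    have h1 := mul_pos h t.2.1
    have h2 := mul_lt_mul_of_pos_left t.2.2 h
    constructor <;> simp only [m] <;> linarith
  let Φ : (Σ _ : ι, Ioo (0 : ℝ) 1) → ℝ := fun z => m z.1 z.2
  have hΦ : IsOpenEmbedding Φ := by
    refine .of_continuous_injective_isOpenMap (continuous_sigma fun c => (hm c).continuous) ?_
      (isOpenMap_sigma.2 fun c => (hm c).isOpenMap)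
    rintro ⟨c, t⟩ ⟨c', t'⟩ h
    have h' : m c t = m c' t' := h
    obtain rfl : c = c' := Subtype.ext (heq c c.2 c' c'.2 _ (hmem c t) (h' ▸ hmem c' t'))
    rw [(hm c).injective h']
  have hrange : range Φ = U := by
    refine Subset.antisymm (range_subset_iff.2 fun z => hsub _ z.1.2 (hmem z.1 z.2)) fun x hx => ?_
    let c : ι := ⟨_, x, hx, rfl⟩
    have hxc : x ∈ Ioo (a c) (b c) := hc c ▸ mem_connectedComponentIn hx
    have h := sub_pos.2 (hab c)
    refine ⟨⟨c, (x - a c) / (b c - a c), div_pos (sub_pos.2 hxc.1) h,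
      (div_lt_one h).2 (by linarith [hxc.2])⟩, ?_⟩
    simp only [Φ, m]
    field_simp
    ring
  exact ⟨ι, hcount.to_subtype, ⟨(Homeomorph.setCongr hrange.symm).trans
    hΦ.isEmbedding.toHomeomorph.symm⟩⟩

end OpenArcs

/-! ### The Cantor set contains 1 and omits `1/2`. -/

section CantorSet

theorem one_mem_cantorSet : (1 : ℝ) ∈ cantorSet := by
  refine mem_iInter.2 fun n => ?_
  induction n with
  | zero => simp
  | succ n ih => exact .inr ⟨1, ih, by norm_num⟩

theorem half_notMem_cantorSet : (1 / 2 : ℝ) ∉ cantorSet := by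
  intro h
  rcases mem_iInter.1 h 1 with ⟨x, hx, h⟩ | ⟨x, hx, h⟩ <;> simp only [preCantorSet_zero] at hx
  · have := hx.2
    simp only at h
    linarith
  · have := hx.1
    simp only at h
    linarith

end CantorSet

/-! ### The adjunction space and the ends of its gaps. -/

section AttachArcs

/-- Attaching the unit interval to a compact metric space along a closed subset of the interval. -/
theorem exists_attach_unitInterval (X : Type u) [MetricSpace X] [CompactSpace X] [Nonempty X]
    {C : Set unitInterval} (hC : IsClosed C) (hCne : C.Nonempty) (f : C(C, X))
    (hf : Function.Surjective f) :
    ∃ (Y : Type u) (_ : TopologicalSpace Y) (φ : C(unitInterval, Y)) (i : C(X, Y)),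
      TopologicalSpace.MetrizableSpace Y ∧ Function.Surjective φ ∧ IsClosedEmbedding i ∧
      (∀ t : C, φ t = i (f t)) ∧ (∀ t ∉ C, φ t ∉ range i) ∧
      ∀ s ∉ C, ∀ t, φ s = φ t → s = t := by
  -- Distances to a dense sequence embed `X` in a product of lines, where `f` extends over the
  -- interval by Tietze; `ULift` keeps `Y` in `Type u`.
  let e : C(X, ULift.{u} ℕ → ℝ) :=
    ⟨fun x n => dist x (TopologicalSpace.denseSeq X n.down), by fun_prop⟩
  have he : Function.Injective e := by
    intro x y hxy
    have hcl : IsClosed {z | dist x z = dist y z} :=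
      isClosed_eq (by fun_prop) (by fun_prop)
    have hsub : closure (range (TopologicalSpace.denseSeq X)) ⊆ {z | dist x z = dist y z} :=
      closure_minimal (range_subset_iff.2 fun n => congrFun hxy ⟨n⟩) hcl
    have hx : dist x x = dist y x :=
      hsub ((TopologicalSpace.denseRange_denseSeq X).closure_range ▸ mem_univ x)
    exact (dist_eq_zero.1 (hx ▸ dist_self x)).symm
  obtain ⟨F, hF⟩ := (e.comp f).exists_restrict_eq hC
  have hF' : ∀ t : C, F t = e (f t) := fun t => congrArg (fun g => g t) hF
  -- The second coordinate vanishes exactly on `C`; off `C`, the ratio of the third to the second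
  -- recovers `t`. So `φ₀` makes only the identifications prescribed by `f`.
  let φ₀ : C(unitInterval, (ULift.{u} ℕ → ℝ) × ℝ × ℝ) :=
    ⟨fun t => (F t, Metric.infDist t C, (t : ℝ) * Metric.infDist t C),
      F.continuous.prodMk ((Metric.continuous_infDist_pt C).prodMk
        (continuous_subtype_val.mul (Metric.continuous_infDist_pt C)))⟩
  have hd : ∀ t, Metric.infDist t C = 0 ↔ t ∈ C := fun t => (hC.mem_iff_infDist_zero hCne).symm
  have hφC : ∀ t : C, φ₀ t = (e (f t), 0, 0) := fun t => by
    simp only [φ₀, ContinuousMap.coe_mk, (hd t).2 t.2, hF', mul_zero]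
  let i₀ : C(X, range φ₀) := ⟨fun x => ⟨(e x, 0, 0), by
    obtain ⟨t, rfl⟩ := hf x
    exact ⟨t, hφC t⟩⟩, by fun_prop⟩
  refine ⟨range φ₀, inferInstance, ⟨rangeFactorization φ₀, φ₀.continuous.rangeFactorization⟩, i₀,
    inferInstance, rangeFactorization_surjective, i₀.continuous.isClosedEmbedding ?_,
    fun t => Subtype.ext (hφC t), ?_, ?_⟩
  · intro x y hxy
    exact he (congrArg (fun z : range φ₀ => z.1.1) hxy)
  · rintro t ht ⟨x, hx⟩
    have h : (0 : ℝ) = Metric.infDist t C :=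
      congrArg (fun z : range φ₀ => z.1.2.1) hx
    exact ht ((hd t).1 h.symm)
  · intro s hs t hst
    have h : φ₀ s = φ₀ t := congrArg Subtype.val hst
    have h1 : Metric.infDist s C = Metric.infDist t C := congrArg (fun z => z.2.1) h
    have h2 : (s : ℝ) * Metric.infDist s C = t * Metric.infDist t C := congrArg (fun z => z.2.2) h
    rw [← h1] at h2
    exact Subtype.ext (mul_right_cancel₀ (fun h0 => hs ((hd s).1 h0)) h2)

/-- `T` is order-convex, so a limit point outside `T` is its supremum or infimum. -/
theorem finite_closure_inter_of_isPreconnected {α : Type*} [LinearOrder α] [TopologicalSpace α]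
    [OrderTopology α] {T C : Set α} (hT : IsPreconnected T) (hTC : Disjoint T C) :
    (closure T ∩ C).Finite := by
  have hlub : {t | IsLUB T t}.Subsingleton := fun s hs t ht => hs.unique ht
  have hglb : {t | IsGLB T t}.Subsingleton := fun s hs t ht => hs.unique ht
  refine (hlub.finite.union hglb.finite).subset ?_
  rintro t ⟨htT, htC⟩
  have ht : t ∉ T := fun h => hTC.le_bot ⟨h, htC⟩
  by_cases hu : t ∈ upperBounds T
  · exact .inl (isLUB_of_mem_closure hu htT)
  by_cases hl : t ∈ lowerBounds T
  · exact .inr (isGLB_of_mem_closure hl htT)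
  simp only [mem_upperBounds, mem_lowerBounds, not_forall, not_le] at hu hl
  obtain ⟨x, hx, hxt⟩ := hu
  obtain ⟨y, hy, hyt⟩ := hl
  exact (ht (hT.ordConnected.out hy hx ⟨hyt.le, hxt.le⟩)).elim

end AttachArcs

/-! ### Assembling the theorem. -/

theorem lemma5p1 (n : ℕ) (hn : 1 ≤ n) (X : Type u) [MetricSpace X] [CompactSpace X]
    [Nonempty X] :
    ∃ (Y : Type u) (_ : TopologicalSpace Y) (_ : IsPeanoContinuum Y) (i : C(X, Y)),
      Topology.IsEmbedding i ∧
      IsCountableDisjointUnionOfOpenArcs (range i)ᶜ ∧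
      IsPiOneInjective i ∧
      i '' wildSet n X ⊆ wildSet n Y ∧
      wildSet n Y ⊆ range i ∧
      coveringDim Y = max 1 (coveringDim X) := by
  let C : Set unitInterval := Subtype.val ⁻¹' cantorSet
  have hC : IsClosed C := isClosed_cantorSet.preimage continuous_subtype_val
  obtain ⟨f₀, hf₀, hf₀s⟩ := exists_nat_bool_continuous_surjective_of_compact X
  let f : C(C, X) := ⟨fun t => f₀ (cantorSetHomeomorphNatToBool ⟨_, t.2⟩),
    hf₀.comp (cantorSetHomeomorphNatToBool.continuous.comp (by fun_prop))⟩
  have hfs : Function.Surjective f := by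
    intro x
    obtain ⟨z, rfl⟩ := hf₀s x
    obtain ⟨c, rfl⟩ := cantorSetHomeomorphNatToBool.surjective z
    exact ⟨⟨⟨c, cantorSet_subset_unitInterval c.2⟩, c.2⟩, rfl⟩
  obtain ⟨Y, _, φ, i, hmet, hφs, hi, hφC, hφC', hφinj⟩ :=
    exists_attach_unitInterval X hC ⟨0, zero_mem_cantorSet⟩ f hfs
  have hφq : IsQuotientMap φ := IsQuotientMap.of_surjective_continuous hφs φ.continuous
  have : LocallyPathConnectedSpace unitInterval := (convex_Icc (0 : ℝ) 1).locallyPathConnectedSpace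
  have hcomp : CompactSpace Y := hφs.compactSpace φ.continuous
  have hconn : ConnectedSpace Y := hφs.connectedSpace φ.continuous
  have hpeano : IsPeanoContinuum Y :=
    ⟨hmet, hcomp, hconn, hφq.isCoinducing.locallyConnectedSpace⟩
  have hpre : ∀ t, φ t ∈ range i ↔ t ∈ C := fun t =>
    ⟨fun h => by_contra fun ht => hφC' t ht h, fun ht => ⟨_, (hφC ⟨t, ht⟩).symm⟩⟩
  let m : C(↥Cᶜ, Y) := φ.comp ⟨Subtype.val, continuous_subtype_val⟩
  have hm : IsOpenEmbedding m := by
    refine .of_continuous_injective_isOpenMap m.continuous ?_ ?_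
    · exact fun s t hst => Subtype.ext (hφinj s s.2 t hst)
    · intro V hV
      rw [← hφq.isOpen_preimage]
      -- Nothing off `C` is glued, so such sets are saturated for the quotient map `φ`.
      have : φ ⁻¹' (m '' V) = Subtype.val '' V := by
        ext t
        constructor
        · rintro ⟨s, hs, hst⟩
          exact ⟨s, hs, hφinj s s.2 t hst⟩
        · rintro ⟨s, hs, rfl⟩
          exact ⟨s, hs, rfl⟩
      rw [this]
      exact hC.isOpen_compl.isOpenMap_subtype_val V hV
  have hmr : range m = (range i)ᶜ := by
    ext y
    constructor
    · rintro ⟨t, rfl⟩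
      exact hφC' t t.2
    · intro hy
      obtain ⟨t, rfl⟩ := hφs y
      exact ⟨⟨t, fun ht => hy ((hpre t).2 ht)⟩, rfl⟩
  have hends : ∀ T ⊆ (range i)ᶜ, IsPreconnected T → (closure T ∩ range i).Finite := by
    intro T hT hTc
    have hTm : m '' (m ⁻¹' T) = T := image_preimage_eq_of_subset (hmr ▸ hT)
    have h1 : IsPreconnected (m ⁻¹' T) := hm.isInducing.isPreconnected_image.1 (hTm.symm ▸ hTc)
    have h2 : IsPreconnected (Subtype.val '' (m ⁻¹' T)) :=
      h1.image _ continuous_subtype_val.continuousOn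
    have h3 := finite_closure_inter_of_isPreconnected h2 (C := C)
      (disjoint_left.2 (by rintro _ ⟨t, -, rfl⟩; exact t.2))
    refine (h3.image φ).subset ?_
    rintro y ⟨hyT, hyi⟩
    -- By compactness every limit point of `T` comes from a limit point in the interval, where `T`
    -- has at most two ends in `C`.
    have h4 : closure T ⊆ φ '' closure (Subtype.val '' (m ⁻¹' T)) := by
      refine closure_minimal ?_ (isClosed_closure.isCompact.image φ.continuous).isClosed
      intro z hz
      rw [← hTm] at hz
      obtain ⟨t, ht, rfl⟩ := hz
      exact ⟨t, subset_closure ⟨t, ht, rfl⟩, rfl⟩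
    obtain ⟨t, ht, rfl⟩ := h4 hyT
    exact ⟨t, ⟨ht, (hpre t).1 hyi⟩, rfl⟩
  have harcs : IsCountableDisjointUnionOfOpenArcs (range i)ᶜ := by
    let k : ↥Cᶜ → ℝ := fun t => t
    have hk : IsEmbedding k := IsEmbedding.subtypeVal.comp IsEmbedding.subtypeVal
    -- Since 0 and 1 belong to the Cantor set, the gaps are open in `ℝ`, not just in `[0,1]`.
    have hkr : range k = Ioo 0 1 \ cantorSet := by
      ext x
      constructor
      · rintro ⟨t, rfl⟩
        refine ⟨⟨lt_of_le_of_ne t.1.2.1 fun h => t.2 ?_, lt_of_le_of_ne t.1.2.2 fun h => t.2 ?_⟩,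
          t.2⟩
        · exact show k t ∈ cantorSet from h ▸ zero_mem_cantorSet
        · exact show k t ∈ cantorSet from h ▸ one_mem_cantorSet
      · rintro ⟨hx, hxC⟩
        exact ⟨⟨⟨x, Ioo_subset_Icc_self hx⟩, hxC⟩, rfl⟩
    have hU : IsOpen (range k) := hkr ▸ isOpen_Ioo.sdiff isClosed_cantorSet
    have hb : Bornology.IsBounded (range k) := hkr ▸ (Metric.isBounded_Ioo 0 1).subset sdiff_subset
    obtain ⟨ι, hι, ⟨E⟩⟩ := isCountableDisjointUnionOfOpenArcs_of_isOpen hU hb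
    exact ⟨ι, hι, ⟨(Homeomorph.setCongr hmr.symm).trans (hm.isEmbedding.toHomeomorph.symm.trans
      (hk.toHomeomorph.trans E))⟩⟩
  -- The image of `1/2` lies off `X`, so `Y` has two points even when `X` is a single point.
  have hnt : Nontrivial Y :=
    ⟨φ ⟨1 / 2, by norm_num, by norm_num⟩, i (Classical.arbitrary X), fun h =>
      hφC' ⟨1 / 2, by norm_num, by norm_num⟩ half_notMem_cantorSet ⟨_, h.symm⟩⟩
  have hdisj : ∀ K : Set Y, IsClosed K → K ⊆ (range i)ᶜ →
      HasCoveringDimLE K (max 1 (coveringDim X)) := by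
    intro K hK hKi
    have hlift : ∀ y : K, ∃ t, φ t = y := fun y => hφs y
    choose j hj using hlift
    refine (hasCoveringDimLE_unitInterval.of_isClosedEmbedding (i := j) ?_).mono (le_max_left _ _)
    have hjC : ∀ y, j y ∈ Cᶜ := fun y hy => hKi y.2 (hj y ▸ (hpre _).2 hy)
    have hjm : ∀ y : K, m ⟨j y, hjC y⟩ = y := hj
    have hcont : Continuous fun y : K => (⟨j y, hjC y⟩ : ↥Cᶜ) :=
      hm.isInducing.continuous_iff.2 (by
        rw [show m ∘ (fun y : K => (⟨j y, hjC y⟩ : ↥Cᶜ)) = Subtype.val from funext hjm]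
        exact continuous_subtype_val)
    have := isCompact_iff_compactSpace.1 hK.isCompact
    refine (continuous_subtype_val.comp hcont).isClosedEmbedding fun y z hyz => Subtype.ext ?_
    have hyz' : j y = j z := hyz
    rw [← hj y, ← hj z, hyz']
  refine ⟨Y, _, hpeano, i, hi.isEmbedding, harcs, isPiOneInjective_of_finite_ends hi hends,
    image_wildSet_subset_of_finite_ends hn hi hends,
    wildSet_subset_of_openArcs n hi.isClosed_range harcs, le_antisymm ?_ (max_le ?_ ?_)⟩
  · exact sInf_le (hasCoveringDimLE_of_closed_of_disjoint_closed hi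
      ((hasCoveringDimLE_coveringDim X).mono (le_max_right _ _)) hdisj)
  · exact (hasCoveringDimLE_coveringDim Y).one_le
  · exact sInf_le ((hasCoveringDimLE_coveringDim Y).of_isClosedEmbedding hi)
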